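/- Let $(\mathcal X,\mathcal A,P,g,h,\gamma)$ be a discounted Markov decision process, where $\mathcal X$ and $\mathcal A$ are measurable spaces (for instance Borel subsets of $\mathbb R^n$ and $\mathbb R^m$), $P(\cdot\mid x,a)$ is a Markov transition kernel from $\mathcal X\times\mathcal A$ to $\mathcal X$ (so $\mathcal X$ is forward invariant), and $\gamma\in(0,1)$. Let $\mathcal T,\mathcal F\subset\mathcal X$ be disjoint measurable sets (target set and unsafe set), let $M>0$, and let $g,h:\mathcal X\to\mathbb R$ be bounded measurable functions with $$g(x)=-M \ \text{ if } x\in\mathcal T,\qquad g(x)>0\ \text{ if } x\notin\mathcal T,\qquad h(x)=M\ \text{ if } x\in\mathcal F,\qquad h(x)=-M\ \text{ if } x\notin\mathcal F.$$ Let $\pi(\cdot\mid x)$ be a stochastic policy, i.e. a Markov kernel from $\mathcal X$ to $\mathcal A$, and let $\mathbb P_\pi(\mathbf{RA}_x)$ be the probability that the trajectory $x_0=x$, $a_t\sim\pi(\cdot\mid x_t)$, $x_{t+1}\sim P(\cdot\mid x_t,a_t)$ satisfies $T:=\inf\{t\ge 0: x_t\in\mathcal T\}<\infty$ and $x_t\notin\mathcal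 F$ for all $0\le t\le T$. Then the reach-avoid Bellman operator $$B^\pi[V](x)=\max\Bigl\{h(x),\,\min\bigl\{g(x),\,\gamma\,\mathbb E_{a\sim\pi(\cdot\mid x),\,x'\sim P(\cdot\mid x,a)}[V(x')]\bigr\}\Bigr\}$$ has exactly one fixed point $V_{g,h}^\pi$ among the bounded measurable functions $V:\mathcal X\to\mathbb R$, and for every $x\in\mathcal X$ with $V_{g,h}^\pi(x)<0$, $$\mathbb P_\pi(\mathbf{RA}_x)\;\ge\;-\frac{V_{g,h}^\pi(x)}{M}.$$ In particular, $V_{g,h}^\pi$ certifies reach-avoid probabilities (it is a reach-avoid probability certificate): for every $p\in(0,1)$, $\mathbb P_\pi(\mathbf{RA}_x)\ge p$ for every $x$ with $V_{g,h}^\pi(x)\le -pM$. -/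

import Mathlib

open MeasureTheory ProbabilityTheory

/-- A discounted Markov decision process with a reach-avoid specification, on a measurable state
space `S` and a measurable action space `A`. For Borel sets of states and actions in Euclidean
spaces, `S` and `A` are the corresponding subtypes; since `P` is a Markov kernel with values in the
probability measures on `S`, the state space is forward invariant. -/
structure ReachAvoidMDP (S A : Type*) [MeasurableSpace S] [MeasurableSpace A] where
  /-- transition kernel `P(· ∣ x, a)` -/
  P : Kernel (S × A) S
  markov : IsMarkovKernel P
  /-- discount factor -/
  γ : ℝ
  γ_pos : 0 < γ
  γ_lt_one : γ < 1
  /-- target set `𝒯` -/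
  target : Set S
  measurableSet_target : MeasurableSet target
  /-- the set of states to be avoided, `ℱ` -/
  avoid : Set S
  measurableSet_avoid : MeasurableSet avoid
  disjoint : Disjoint target avoid
  M : ℝ
  M_pos : 0 < M
  /-- `g = -M` on the target set and `g > 0` elsewhere; `g` is bounded -/
  g : S → ℝ
  measurable_g : Measurable g
  bounded_g : ∃ C : ℝ, ∀ x, |g x| ≤ C
  g_of_mem : ∀ x ∈ target, g x = -M
  g_of_notMem : ∀ x ∉ target, 0 < g x
  /-- `h = M` on the avoid set and `h = -M` elsewhere -/
  h : S → ℝ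
  h_of_mem : ∀ x ∈ avoid, h x = M
  h_of_notMem : ∀ x ∉ avoid, h x = -M

namespace ReachAvoidMDP

section

variable {S A : Type*} [MeasurableSpace S] [MeasurableSpace A]

attribute [instance] ReachAvoidMDP.markov

/-- One step of the state-action process: from `(x, a)` draw `x' ∼ P(· ∣ x, a)` and then
`a' ∼ π(· ∣ x')`. -/
noncomputable def stepKernel (D : ReachAvoidMDP S A) (π : Kernel S A) : Kernel (S × A) (S × A) :=
  D.P.compProd (Kernel.prodMkLeft (S × A) π)

instance instIsMarkovKernelStepKernel (D : ReachAvoidMDP S A) (π : Kernel S A)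
    [IsMarkovKernel π] : IsMarkovKernel (D.stepKernel π) := by
  unfold stepKernel; infer_instance

/-- The step kernel as a kernel on histories `(x₀, a₀), …, (xₙ, aₙ)`: it depends on the history
only through `(xₙ, aₙ)`. -/
noncomputable def historyKernel (D : ReachAvoidMDP S A) (π : Kernel S A) (n : ℕ) :
    Kernel (Finset.Iic n → S × A) (S × A) :=
  (D.stepKernel π).comap (fun w => w ⟨n, Finset.mem_Iic.2 le_rfl⟩) (measurable_pi_apply _)

instance instIsMarkovKernelHistoryKernel (D : ReachAvoidMDP S A) (π : Kernel S A)
    [IsMarkovKernel π] (n : ℕ) : IsMarkovKernel (D.historyKernel π n) := by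
  unfold historyKernel; infer_instance

/-- The law of the trajectory `(x_t, a_t)_{t ≥ 0}` under the policy `π` started at `x₀ = x`
(Ionescu-Tulcea): `x₀ = x`, `a_t ∼ π(· ∣ x_t)`, `x_{t+1} ∼ P(· ∣ x_t, a_t)`. -/
noncomputable def trajLaw (D : ReachAvoidMDP S A) (π : Kernel S A) [IsMarkovKernel π] (x : S) :
    Measure (ℕ → S × A) :=
  Kernel.trajMeasure (X := fun _ => S × A) ((Measure.dirac x).compProd π) (D.historyKernel π)

/-- The hitting time `T(τ) = inf {t ≥ 0 : x_t ∈ 𝒯}`, equal to `⊤` if the target is never hit. -/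
noncomputable def hitTime (D : ReachAvoidMDP S A) (τ : ℕ → S × A) : ℕ∞ :=
  ⨅ (t : ℕ) (_ : (τ t).1 ∈ D.target), (t : ℕ∞)

/-- The reach-avoid event: the target is hit, and no state up to and including the hitting time
lies in the avoid set. -/
def reachAvoidEvent (D : ReachAvoidMDP S A) : Set (ℕ → S × A) :=
  {τ | D.hitTime τ < ⊤ ∧ ∀ t : ℕ, (t : ℕ∞) ≤ D.hitTime τ → (τ t).1 ∉ D.avoid}

/-- The reach-avoid probability from the initial state `x` under the policy `π`. -/
noncomputable def reachAvoidProb (D : ReachAvoidMDP S A) (π : Kernel S A) [IsMarkovKernel π]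
    (x : S) : ℝ :=
  (D.trajLaw π x).real D.reachAvoidEvent

/-- The `p`-reach-avoid set of the policy `π`. -/
def reachAvoidSet (D : ReachAvoidMDP S A) (π : Kernel S A) [IsMarkovKernel π] (p : ℝ) : Set S :=
  {x | p ≤ D.reachAvoidProb π x}

/-- The reach-avoid Bellman operator
`B^π[V](x) = max {h(x), min {g(x), γ 𝔼_{a ∼ π(· ∣ x), x' ∼ P(· ∣ x, a)} [V(x')]}}`. -/
noncomputable def bellman (D : ReachAvoidMDP S A) (π : Kernel S A) (V : S → ℝ) (x : S) : ℝ :=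
  max (D.h x) (min (D.g x) (D.γ * ∫ a, ∫ x', V x' ∂(D.P (x, a)) ∂(π x)))

/-- `V` is a fixed point of the reach-avoid Bellman operator in the space of bounded measurable
functions. -/
def IsBellmanFixedPoint (D : ReachAvoidMDP S A) (π : Kernel S A) (V : S → ℝ) : Prop :=
  Measurable V ∧ (∃ C : ℝ, ∀ x, |V x| ≤ C) ∧ D.bellman π V = V

end

end ReachAvoidMDP

open Filter Topology
open scoped ENNReal

/-! The operator is a `γ`-contraction in sup norm (`abs_bellman_sub_le`), which gives the unique
fixed point. For the bound put `u = max (-V / M) 0`. Since `V ≥ h ≥ -M`, `u ≤ 1`; on the avoid set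
`V ≥ M`, so `u = 0`; off both sets, `V < 0 < g` forces `γ 𝔼 V ≤ V`, so `u ≤ γ 𝔼 u`. Thus, until the
trajectory is decided, `u` is dominated by its discounted mean one step ahead.

Iterating `n` times bounds `u x` by the probability of a safe hit before time `n` plus a remainder
of at most `γ ^ n`, which vanishes. Since the trajectory runs on state-action pairs, the iteration
is done for `stateActionValue`, whose mean over the action dominates `u`. -/

/-- Integrability is not needed: the Bochner integral of a non-integrable function is `0`. -/
theorem ofReal_integral_le_lintegral_ofReal {α : Type*} [MeasurableSpace α] (μ : Measure α)
    (f : α → ℝ) : ENNReal.ofReal (∫ x, f x ∂μ) ≤ ∫⁻ x, ENNReal.ofReal (f x) ∂μ := by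
  by_cases hf : Integrable f μ
  · calc ENNReal.ofReal (∫ x, f x ∂μ) ≤ ENNReal.ofReal (∫ x, max (f x) 0 ∂μ) :=
          ENNReal.ofReal_le_ofReal (integral_mono hf hf.pos_part fun x => le_max_left _ _)
      _ = ∫⁻ x, ENNReal.ofReal (max (f x) 0) ∂μ :=
          ofReal_integral_eq_lintegral_ofReal hf.pos_part (ae_of_all _ fun x => le_max_right _ _)
      _ = ∫⁻ x, ENNReal.ofReal (f x) ∂μ := by simp
  · simp [integral_undef hf]

theorem abs_integral_sub_integral_le {α : Type*} [MeasurableSpace α] (μ : Measure α)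
    [IsProbabilityMeasure μ] {f g : α → ℝ} (hf : Integrable f μ) (hg : Integrable g μ) {c : ℝ}
    (h : ∀ x, |f x - g x| ≤ c) : |∫ x, f x ∂μ - ∫ x, g x ∂μ| ≤ c := by
  rw [← integral_sub hf hg]
  simpa using norm_integral_le_of_norm_le_const (μ := μ) (f := fun x => f x - g x)
    (ae_of_all _ h)

/-- The Markov property of a trajectory law, for an event determined by the history up to time
`n` and a function of the position at time `n + 1`. -/
theorem setLIntegral_trajMeasure_succ {X : Type*} [MeasurableSpace X] (μ₀ : Measure X)
    [IsProbabilityMeasure μ₀] (κ : (n : ℕ) → Kernel (Finset.Iic n → X) X)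
    [∀ n, IsMarkovKernel (κ n)] (n : ℕ) {s : Set (Finset.Iic n → X)} (hs : MeasurableSet s)
    {φ : X → ℝ≥0∞} (hφ : Measurable φ) :
    ∫⁻ τ in Preorder.frestrictLe n ⁻¹' s, φ (τ (n + 1))
        ∂(Kernel.trajMeasure (X := fun _ => X) μ₀ κ) =
      ∫⁻ τ in Preorder.frestrictLe n ⁻¹' s, ∫⁻ y, φ y ∂(κ n (Preorder.frestrictLe n τ))
        ∂(Kernel.trajMeasure (X := fun _ => X) μ₀ κ) := by
  have hr : Measurable (Preorder.frestrictLe (π := fun _ : ℕ => X) n) := by fun_prop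
  have hF : Measurable fun p : (Finset.Iic n → X) × X => s.indicator (fun _ => φ p.2) p.1 := by
    have : (fun p : (Finset.Iic n → X) × X => s.indicator (fun _ => φ p.2) p.1) =
        (Prod.fst ⁻¹' s).indicator fun p => φ p.2 := rfl
    rw [this]
    exact (hφ.comp measurable_snd).indicator (measurable_fst hs)
  -- The joint law of the history up to `n` and the next position is the history law composed with
  -- `κ n`; integrate `1_s ⊗ φ` against both.
  have key := congrArg (fun μ => ∫⁻ p, s.indicator (fun _ => φ p.2) p.1 ∂μ)
    (Kernel.map_frestrictLe_trajMeasure_compProd_eq_map_trajMeasure (X := fun _ => X)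
      (μ₀ := μ₀) (κ := κ) (a := n))
  rw [Measure.lintegral_compProd hF, lintegral_map (by fun_prop) hr,
    lintegral_map hF (by fun_prop)] at key
  rw [← lintegral_indicator (hr hs), ← lintegral_indicator (hr hs)]
  refine Eq.trans ?_ (key.symm.trans ?_)
  · rfl
  · refine lintegral_congr fun τ => ?_
    by_cases h : Preorder.frestrictLe n τ ∈ s
    · simp [Set.indicator, h]
    · simp [Set.indicator, h]

theorem lintegral_trajMeasure_zero {X : Type*} [MeasurableSpace X] (μ₀ : Measure X)
    [IsProbabilityMeasure μ₀] (κ : (n : ℕ) → Kernel (Finset.Iic n → X) X)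
    [∀ n, IsMarkovKernel (κ n)] {φ : X → ℝ≥0∞} (hφ : Measurable φ) :
    ∫⁻ τ, φ (τ 0) ∂(Kernel.trajMeasure (X := fun _ => X) μ₀ κ) = ∫⁻ y, φ y ∂μ₀ := by
  have hr : Measurable (Preorder.frestrictLe (π := fun _ : ℕ => X) 0) := by fun_prop
  have h0 : (Kernel.trajMeasure (X := fun _ => X) μ₀ κ).map (Preorder.frestrictLe 0) =
      μ₀.map (MeasurableEquiv.piUnique (fun _ : Finset.Iic 0 => X)).symm := by
    rw [Kernel.trajMeasure, Measure.map_comp _ _ hr, Kernel.traj_map_frestrictLe,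
      Kernel.partialTraj_self, Measure.id_comp]
  have hψ : Measurable fun w : Finset.Iic 0 → X => φ (w ⟨0, Finset.mem_Iic.2 le_rfl⟩) := by
    fun_prop
  have key := congrArg (fun μ => ∫⁻ w, φ (w ⟨0, Finset.mem_Iic.2 le_rfl⟩) ∂μ) h0
  rw [lintegral_map hψ hr, lintegral_map hψ (MeasurableEquiv.measurable _)] at key
  exact key

/-! ### The Bellman operator and its fixed point -/

namespace ReachAvoidMDP

variable {S A : Type*} [MeasurableSpace S] [MeasurableSpace A] (D : ReachAvoidMDP S A)
  (π : Kernel S A)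

theorem measurable_h : Measurable D.h := by
  classical
  have : D.h = D.avoid.piecewise (fun _ => D.M) fun _ => -D.M := by
    ext x
    by_cases hx : x ∈ D.avoid
    · simp [hx, D.h_of_mem x hx]
    · simp [hx, D.h_of_notMem x hx]
  rw [this]
  exact Measurable.piecewise D.measurableSet_avoid measurable_const measurable_const

theorem abs_h (x : S) : |D.h x| = D.M := by
  by_cases hx : x ∈ D.avoid
  · simp [D.h_of_mem x hx, D.M_pos.le]
  · simp [D.h_of_notMem x hx, D.M_pos.le]

theorem neg_M_le_h (x : S) : -D.M ≤ D.h x := by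
  have := neg_abs_le (D.h x)
  rwa [D.abs_h] at this

theorem measurable_inner {V : S → ℝ} (hV : Measurable V) :
    Measurable fun y : S × A => ∫ x', V x' ∂(D.P y) :=
  (hV.stronglyMeasurable.comp_measurable measurable_snd).integral_kernel_prod_right'.measurable

theorem abs_inner_le {V : S → ℝ} {C : ℝ} (hC : ∀ x, |V x| ≤ C) (y : S × A) :
    |∫ x', V x' ∂(D.P y)| ≤ C := by
  simpa using norm_integral_le_of_norm_le_const (μ := D.P y) (f := V) (ae_of_all _ hC)

/-- The bound is uniform in `V`, because the value is clamped between `h` and `max h g`. -/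
theorem bellman_bounded : ∃ C : ℝ, ∀ (V : S → ℝ) x, |D.bellman π V x| ≤ C := by
  obtain ⟨G, hG⟩ := D.bounded_g
  refine ⟨max D.M G, fun V x => abs_le.2 ⟨?_, ?_⟩⟩
  · exact (neg_le_neg (le_max_left _ _)).trans ((D.neg_M_le_h x).trans (le_max_left _ _))
  · exact max_le_max ((le_abs_self _).trans (D.abs_h x).le)
      ((min_le_left _ _).trans ((le_abs_self _).trans (hG x)))

section

variable [IsMarkovKernel π]

theorem measurable_bellman {V : S → ℝ} (hV : Measurable V) : Measurable (D.bellman π V) := by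
  have := (D.measurable_inner hV).stronglyMeasurable.integral_kernel_prod_right' (κ := π)
  exact D.measurable_h.max (D.measurable_g.min (this.measurable.const_mul _))

/-- Averaging, `max` and `min` are all nonexpansive, so only the factor `γ` remains. -/
theorem abs_bellman_sub_le {V W : S → ℝ} (hV : Measurable V) (hW : Measurable W)
    (bV : ∃ C : ℝ, ∀ x, |V x| ≤ C) (bW : ∃ C : ℝ, ∀ x, |W x| ≤ C) {c : ℝ}
    (h : ∀ x, |V x - W x| ≤ c) (x : S) : |D.bellman π V x - D.bellman π W x| ≤ D.γ * c := by
  obtain ⟨C, hC⟩ := bV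
  obtain ⟨C', hC'⟩ := bW
  have hc : 0 ≤ c := (abs_nonneg _).trans (h x)
  have hγc : 0 ≤ D.γ * c := mul_nonneg D.γ_pos.le hc
  have inner (a : A) : |∫ x', V x' ∂(D.P (x, a)) - ∫ x', W x' ∂(D.P (x, a))| ≤ c :=
    abs_integral_sub_integral_le _
      (Integrable.of_bound hV.aestronglyMeasurable C (ae_of_all _ hC))
      (Integrable.of_bound hW.aestronglyMeasurable C' (ae_of_all _ hC')) h
  have outer := abs_integral_sub_integral_le (π x)
    (Integrable.of_bound ((D.measurable_inner hV).comp measurable_prodMk_left).aestronglyMeasurable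
      C (ae_of_all _ fun a => D.abs_inner_le hC (x, a)))
    (Integrable.of_bound ((D.measurable_inner hW).comp measurable_prodMk_left).aestronglyMeasurable
      C' (ae_of_all _ fun a => D.abs_inner_le hC' (x, a))) inner
  refine (abs_max_sub_max_le_max _ _ _ _).trans (max_le (by simpa using hγc) ?_)
  refine (abs_min_sub_min_le_max _ _ _ _).trans (max_le (by simpa using hγc) ?_)
  rw [← mul_sub, abs_mul, abs_of_pos D.γ_pos]
  exact mul_le_mul_of_nonneg_left outer D.γ_pos.le

/-- Banach iteration from `0`, carried out pointwise: geometric increments give a limit, which is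
measurable as a pointwise limit and bounded by the error estimate at `n = 0`. -/
theorem existsUnique_isBellmanFixedPoint : ∃! V : S → ℝ, D.IsBellmanFixedPoint π V := by
  obtain ⟨C, hC⟩ := D.bellman_bounded π
  have hγ := D.γ_pos.le
  refine existsUnique_of_exists_of_unique ?_ ?_
  · let u : ℕ → S → ℝ := fun n => (D.bellman π)^[n] 0
    have hu (n : ℕ) : u (n + 1) = D.bellman π (u n) := Function.iterate_succ_apply' _ _ _
    have mu (n : ℕ) : Measurable (u n) := by
      induction n with
      | zero => exact measurable_const
      | succ n ih => rw [hu]; exact D.measurable_bellman π ih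
    have bu (n : ℕ) : ∃ C : ℝ, ∀ x, |u n x| ≤ C := by
      cases n with
      | zero => exact ⟨0, fun x => by simp [u]⟩
      | succ n => exact ⟨C, fun x => by rw [hu]; exact hC _ x⟩
    have du (n : ℕ) : ∀ x, |u n x - u (n + 1) x| ≤ C * D.γ ^ n := by
      induction n with
      | zero => intro x; simpa [u] using hC 0 x
      | succ n ih =>
        intro x
        rw [hu n, hu (n + 1)]
        refine (D.abs_bellman_sub_le π (mu n) (mu _) (bu n) (bu _) ih x).trans_eq ?_
        ring
    have hlim (x : S) : ∃ v, Tendsto (fun n => u n x) atTop (𝓝 v) :=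
      cauchySeq_tendsto_of_complete
        (cauchySeq_of_le_geometric D.γ C D.γ_lt_one fun n => du n x)
    choose V hV using hlim
    have mV : Measurable V := measurable_of_tendsto_metrizable mu (tendsto_pi_nhds.2 hV)
    have dV (n : ℕ) (x : S) : |u n x - V x| ≤ C * D.γ ^ n / (1 - D.γ) :=
      dist_le_of_le_geometric_of_tendsto D.γ C D.γ_lt_one (fun n => du n x) (hV x) n
    have bV : ∃ C : ℝ, ∀ x, |V x| ≤ C := ⟨C * D.γ ^ 0 / (1 - D.γ), fun x => by
      simpa [u] using dV 0 x⟩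
    refine ⟨V, mV, bV, funext fun x => ?_⟩
    have hz : Tendsto (fun n => D.γ * (C * D.γ ^ n / (1 - D.γ))) atTop (𝓝 0) := by
      have := (((tendsto_pow_atTop_nhds_zero_of_lt_one hγ D.γ_lt_one).const_mul C).div_const
        (1 - D.γ)).const_mul D.γ
      simpa using this
    have hB : Tendsto (fun n => u (n + 1) x) atTop (𝓝 (D.bellman π V x)) := by
      refine tendsto_iff_dist_tendsto_zero.2 (squeeze_zero (fun _ => dist_nonneg) (fun n => ?_) hz)
      rw [hu, Real.dist_eq]
      exact D.abs_bellman_sub_le π (mu n) mV (bu n) bV (dV n) x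
    exact tendsto_nhds_unique hB ((tendsto_add_atTop_iff_nat 1).2 (hV x))
  · rintro V W ⟨mV, ⟨c, hc⟩, fV⟩ ⟨mW, ⟨c', hc'⟩, fW⟩
    -- Each application of the operator to two fixed points shrinks their distance by `γ`.
    have hn (n : ℕ) : ∀ x, |V x - W x| ≤ D.γ ^ n * (c + c') := by
      induction n with
      | zero =>
        intro x
        simpa using (abs_sub _ _).trans (add_le_add (hc x) (hc' x))
      | succ n ih =>
        intro x
        have := D.abs_bellman_sub_le π mV mW ⟨c, hc⟩ ⟨c', hc'⟩ ih x
        rwa [fV, fW, ← mul_assoc, ← pow_succ'] at this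
    funext x
    have hz : Tendsto (fun n => D.γ ^ n * (c + c')) atTop (𝓝 0) := by
      simpa using (tendsto_pow_atTop_nhds_zero_of_lt_one hγ D.γ_lt_one).mul_const (c + c')
    have := ge_of_tendsto' hz fun n => hn n x
    exact sub_eq_zero.1 (abs_nonpos_iff.1 this)

end

/-! ### Safe hitting events and the iteration along trajectories -/

/-- No state before time `n` lies in the target or in the avoid set. -/
def undecidedEvent (n : ℕ) : Set (ℕ → S × A) :=
  {τ | ∀ t < n, (τ t).1 ∉ D.target ∪ D.avoid}

/-- The target is hit at time `n`, and no earlier state lies in the target or the avoid set. -/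
def hitEvent (n : ℕ) : Set (ℕ → S × A) :=
  D.undecidedEvent n ∩ {τ | (τ n).1 ∈ D.target}

theorem measurableSet_undecidedEvent (n : ℕ) :
    MeasurableSet (D.undecidedEvent n : Set (ℕ → S × A)) := by
  have : (D.undecidedEvent n : Set (ℕ → S × A)) =
      ⋂ t < n, (fun τ => (τ t).1) ⁻¹' (D.target ∪ D.avoid)ᶜ := by
    ext τ; simp [undecidedEvent]
  rw [this]
  refine MeasurableSet.iInter fun t => MeasurableSet.iInter fun _ => ?_
  have hm : Measurable fun τ : ℕ → S × A => (τ t).1 := by fun_prop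
  exact hm (D.measurableSet_target.union D.measurableSet_avoid).compl

theorem measurableSet_hitEvent (n : ℕ) : MeasurableSet (D.hitEvent n : Set (ℕ → S × A)) := by
  have hm : Measurable fun τ : ℕ → S × A => (τ n).1 := by fun_prop
  exact (D.measurableSet_undecidedEvent n).inter (hm D.measurableSet_target)

/-- Inclusion suffices for a lower bound, so measurability of `reachAvoidEvent` is never required.
-/
theorem hitEvent_subset (n : ℕ) : (D.hitEvent n : Set (ℕ → S × A)) ⊆ D.reachAvoidEvent := by
  rintro τ ⟨hu, hn⟩
  have hle : D.hitTime τ ≤ n := iInf₂_le n hn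
  refine ⟨hle.trans_lt (ENat.natCast_lt_top n), fun t ht => ?_⟩
  rcases (Nat.cast_le.1 (ht.trans hle)).lt_or_eq with h | rfl
  · exact fun ha => hu t h (Or.inr ha)
  · exact Set.disjoint_left.1 D.disjoint hn

theorem pairwise_disjoint_hitEvent :
    Pairwise (Function.onFun Disjoint fun n => (D.hitEvent n : Set (ℕ → S × A))) := by
  have key {m n : ℕ} (h : m < n) :
      Disjoint (D.hitEvent m : Set (ℕ → S × A)) (D.hitEvent n) :=
    Set.disjoint_left.2 fun τ hm hn => hn.1 m h (Or.inl hm.2)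
  intro m n h
  rcases h.lt_or_gt with h | h
  · exact key h
  · exact (key h).symm

variable [IsMarkovKernel π]

instance instIsProbabilityMeasureTrajLaw (x : S) : IsProbabilityMeasure (D.trajLaw π x) := by
  unfold trajLaw; infer_instance

/-- `undecidedEvent (n + 1)` constrains times `0, …, n` only, so the Markov property at time `n`
applies. -/
theorem setLIntegral_undecidedEvent_succ (x : S) (n : ℕ) {q : S × A → ℝ≥0∞} (hq : Measurable q) :
    ∫⁻ τ in D.undecidedEvent (n + 1), q (τ (n + 1)) ∂(D.trajLaw π x) =
      ∫⁻ τ in D.undecidedEvent (n + 1), ∫⁻ y, q y ∂(D.stepKernel π (τ n)) ∂(D.trajLaw π x) := by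
  let s : Set (Finset.Iic n → S × A) := ⋂ t : Finset.Iic n, {w | (w t).1 ∉ D.target ∪ D.avoid}
  have hs : MeasurableSet s := by
    refine MeasurableSet.iInter fun t => ?_
    have hm : Measurable fun w : Finset.Iic n → S × A => (w t).1 := by fun_prop
    exact hm (D.measurableSet_target.union D.measurableSet_avoid).compl
  have hE : (D.undecidedEvent (n + 1) : Set (ℕ → S × A)) = Preorder.frestrictLe n ⁻¹' s := by
    ext τ; simp [undecidedEvent, s]
  rw [hE]
  exact setLIntegral_trajMeasure_succ _ (D.historyKernel π) n hs hq

/-- A function that is dominated by its discounted mean one step ahead as long as the trajectory is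
undecided is dominated in the mean by the probability of hitting the target safely, up to a
discounted remainder. -/
theorem lintegral_le_sum_hitEvent_add (x : S) {q : S × A → ℝ≥0∞} (hq : Measurable q)
    (h1 : ∀ y, q y ≤ 1) (h0 : ∀ y, y.1 ∈ D.avoid → q y = 0)
    (hstep : ∀ y, y.1 ∉ D.target ∪ D.avoid →
      q y ≤ ENNReal.ofReal D.γ * ∫⁻ z, q z ∂(D.stepKernel π y)) (n : ℕ) :
    ∫⁻ y, q y ∂((Measure.dirac x).compProd π) ≤
      ∑ t ∈ Finset.range n, D.trajLaw π x (D.hitEvent t) +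
        ENNReal.ofReal D.γ ^ n * ∫⁻ τ in D.undecidedEvent n, q (τ n) ∂(D.trajLaw π x) := by
  have hγ : ENNReal.ofReal D.γ ≤ 1 := ENNReal.ofReal_le_one.2 D.γ_lt_one.le
  induction n with
  | zero =>
    have : (D.undecidedEvent 0 : Set (ℕ → S × A)) = Set.univ := by ext; simp [undecidedEvent]
    rw [this, Measure.restrict_univ]
    simp only [Finset.range_zero, Finset.sum_empty, pow_zero, one_mul, zero_add]
    exact (lintegral_trajMeasure_zero _ _ hq).ge
  | succ n ih =>
    -- An undecided trajectory is at time `n` in the target (`q ≤ 1`), in the avoid set (`q = 0`),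
    -- or still undecided (`hstep`).
    have hpt (τ : ℕ → S × A) : (D.undecidedEvent n).indicator (fun τ => q (τ n)) τ ≤
        (D.hitEvent n).indicator 1 τ + ENNReal.ofReal D.γ * (D.undecidedEvent (n + 1)).indicator
          (fun τ => ∫⁻ z, q z ∂(D.stepKernel π (τ n))) τ := by
      by_cases hu : τ ∈ D.undecidedEvent n
      · rw [Set.indicator_of_mem hu]
        by_cases ht : (τ n).1 ∈ D.target
        · rw [Set.indicator_of_mem (show τ ∈ D.hitEvent n from ⟨hu, ht⟩)]
          exact (h1 _).trans le_self_add
        · by_cases ha : (τ n).1 ∈ D.avoid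
          · simp [h0 _ ha]
          · have hn : (τ n).1 ∉ D.target ∪ D.avoid := fun h => h.elim ht ha
            have hu' : τ ∈ D.undecidedEvent (n + 1) := fun t h =>
              (Nat.lt_succ_iff_lt_or_eq.1 h).elim (hu t) fun e => e ▸ hn
            rw [Set.indicator_of_mem hu']
            exact (hstep _ hn).trans le_add_self
      · simp [hu]
    have hint : ∫⁻ τ in D.undecidedEvent n, q (τ n) ∂(D.trajLaw π x) ≤
        D.trajLaw π x (D.hitEvent n) + ENNReal.ofReal D.γ *
          ∫⁻ τ in D.undecidedEvent (n + 1), q (τ (n + 1)) ∂(D.trajLaw π x) := by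
      rw [D.setLIntegral_undecidedEvent_succ π x n hq,
        ← lintegral_indicator (D.measurableSet_undecidedEvent n),
        ← lintegral_indicator (D.measurableSet_undecidedEvent (n + 1)),
        ← lintegral_indicator_one (D.measurableSet_hitEvent n),
        ← lintegral_const_mul' _ _ ENNReal.ofReal_ne_top,
        ← lintegral_add_left (measurable_one.indicator (D.measurableSet_hitEvent n))]
      exact lintegral_mono hpt
    rw [Finset.sum_range_succ, add_assoc]
    refine ih.trans (add_le_add_right ((mul_le_mul_right hint _).trans ?_) _)
    rw [mul_add, ← mul_assoc, ← pow_succ]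
    -- The discount `γ ^ n` on the hitting probability is dropped; that on the remainder is kept.
    exact add_le_add_left (mul_le_of_le_one_left' (pow_le_one' hγ n)) _

theorem lintegral_le_trajLaw_reachAvoidEvent (x : S) {q : S × A → ℝ≥0∞} (hq : Measurable q)
    (h1 : ∀ y, q y ≤ 1) (h0 : ∀ y, y.1 ∈ D.avoid → q y = 0)
    (hstep : ∀ y, y.1 ∉ D.target ∪ D.avoid →
      q y ≤ ENNReal.ofReal D.γ * ∫⁻ z, q z ∂(D.stepKernel π y)) :
    ∫⁻ y, q y ∂((Measure.dirac x).compProd π) ≤ D.trajLaw π x D.reachAvoidEvent := by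
  have hn (n : ℕ) : ∫⁻ y, q y ∂((Measure.dirac x).compProd π) ≤
      D.trajLaw π x D.reachAvoidEvent + ENNReal.ofReal D.γ ^ n := by
    refine (D.lintegral_le_sum_hitEvent_add π x hq h1 h0 hstep n).trans (add_le_add ?_ ?_)
    · rw [← measure_biUnion_finset (fun i _ j _ hij => D.pairwise_disjoint_hitEvent hij)
        fun t _ => D.measurableSet_hitEvent t]
      exact measure_mono (Set.iUnion₂_subset fun t _ => D.hitEvent_subset t)
    · refine mul_le_of_le_one_right' ?_
      refine (lintegral_mono fun τ : ℕ → S × A => h1 (τ n)).trans ?_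
      rw [lintegral_one, Measure.restrict_apply_univ]
      exact prob_le_one
  have hz : Tendsto (fun n : ℕ => D.trajLaw π x D.reachAvoidEvent + ENNReal.ofReal D.γ ^ n) atTop
      (𝓝 (D.trajLaw π x D.reachAvoidEvent + 0)) :=
    (ENNReal.tendsto_pow_atTop_nhds_zero_of_lt_one
      (ENNReal.ofReal_lt_one.2 D.γ_lt_one)).const_add _
  rw [add_zero] at hz
  exact ge_of_tendsto' hz hn

/-! ### From the fixed point to the probability bound -/

/-- The state-action value associated with a lower bound `u` on reach-avoid probabilities. -/
noncomputable def stateActionValue (u : S → ℝ≥0∞) (y : S × A) : ℝ≥0∞ :=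
  (Prod.fst ⁻¹' D.target).indicator 1 y +
    (Prod.fst ⁻¹' (D.target ∪ D.avoid)ᶜ).indicator
      (fun y => ENNReal.ofReal D.γ * ∫⁻ x', u x' ∂(D.P y)) y

theorem measurable_stateActionValue {u : S → ℝ≥0∞} (hu : Measurable u) :
    Measurable (D.stateActionValue u) :=
  (measurable_one.indicator (measurable_fst D.measurableSet_target)).add
    ((hu.lintegral_kernel.const_mul _).indicator
      (measurable_fst (D.measurableSet_target.union D.measurableSet_avoid).compl))

theorem stateActionValue_of_mem_target (u : S → ℝ≥0∞) {y : S × A} (hy : y.1 ∈ D.target) :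
    D.stateActionValue u y = 1 := by
  simp [stateActionValue, hy]

theorem stateActionValue_of_mem_avoid (u : S → ℝ≥0∞) {y : S × A} (hy : y.1 ∈ D.avoid) :
    D.stateActionValue u y = 0 := by
  simp [stateActionValue, hy, Set.disjoint_right.1 D.disjoint hy]

theorem stateActionValue_of_notMem (u : S → ℝ≥0∞) {y : S × A}
    (hy : y.1 ∉ D.target ∪ D.avoid) :
    D.stateActionValue u y = ENNReal.ofReal D.γ * ∫⁻ x', u x' ∂(D.P y) := by
  have ht : y.1 ∉ D.target := fun h => hy (Or.inl h)
  have ha : y.1 ∉ D.avoid := fun h => hy (Or.inr h)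
  simp [stateActionValue, ht, ha]

theorem stateActionValue_le_one {u : S → ℝ≥0∞} (hu : ∀ x, u x ≤ 1) (y : S × A) :
    D.stateActionValue u y ≤ 1 := by
  by_cases ht : y.1 ∈ D.target
  · exact (D.stateActionValue_of_mem_target u ht).le
  by_cases ha : y.1 ∈ D.avoid
  · simp [D.stateActionValue_of_mem_avoid u ha]
  rw [D.stateActionValue_of_notMem u fun h => h.elim ht ha]
  refine mul_le_one' (ENNReal.ofReal_le_one.2 D.γ_lt_one.le) ?_
  refine (lintegral_mono hu).trans ?_
  simp

/-- Integrating `hle` against `P` turns `γ ∫ u` into at most the discounted mean of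
`stateActionValue` under `stepKernel`, the condition needed for the iteration. -/
theorem le_trajLaw_reachAvoidEvent {u : S → ℝ≥0∞} (hu : Measurable u) (h1 : ∀ x, u x ≤ 1)
    (hle : ∀ x, u x ≤ ∫⁻ a, D.stateActionValue u (x, a) ∂(π x)) (x : S) :
    u x ≤ D.trajLaw π x D.reachAvoidEvent := by
  have hq := D.measurable_stateActionValue hu
  refine (hle x).trans (Eq.trans_le ?_ (D.lintegral_le_trajLaw_reachAvoidEvent π x hq
    (D.stateActionValue_le_one h1) (fun y => D.stateActionValue_of_mem_avoid u) fun y hy => ?_))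
  · rw [Measure.lintegral_compProd hq, lintegral_dirac']
    exact hq.lintegral_kernel_prod_right'
  · rw [D.stateActionValue_of_notMem u hy, stepKernel, Kernel.lintegral_compProd _ _ _ hq]
    gcongr with x'
    exact hle x'

theorem ofReal_neg_div_le_trajLaw {V : S → ℝ} (hV : D.IsBellmanFixedPoint π V) (x : S) :
    ENNReal.ofReal (-V x / D.M) ≤ D.trajLaw π x D.reachAvoidEvent := by
  obtain ⟨mV, -, fV⟩ := hV
  have hM := D.M_pos
  refine D.le_trajLaw_reachAvoidEvent π (u := fun x => ENNReal.ofReal (-V x / D.M))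
    (by fun_prop) (fun x => ?_) (fun x => ?_) x
  · rw [ENNReal.ofReal_le_one, div_le_one hM, neg_le, ← fV]
    exact (D.neg_M_le_h x).trans (le_max_left _ _)
  · have h1 : -V x / D.M ≤ 1 := by
      rw [div_le_one hM, neg_le, ← fV]
      exact (D.neg_M_le_h x).trans (le_max_left _ _)
    by_cases ht : x ∈ D.target
    · simpa [D.stateActionValue_of_mem_target, ht] using h1
    rcases le_or_gt 0 (V x) with h0 | h0
    · rw [ENNReal.ofReal_of_nonpos (div_nonpos_of_nonpos_of_nonneg (by linarith) hM.le)]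
      exact zero_le
    have ha : x ∉ D.avoid := fun ha => by
      have : D.h x ≤ V x := by rw [← fV]; exact le_max_left _ _
      rw [D.h_of_mem x ha] at this
      linarith
    -- Off the target `g x > 0 > V x`, so the minimum must be attained by the discounted mean.
    have hB : D.γ * ∫ a, ∫ x', V x' ∂(D.P (x, a)) ∂(π x) ≤ V x := by
      have h2 : min (D.g x) (D.γ * ∫ a, ∫ x', V x' ∂(D.P (x, a)) ∂(π x)) ≤ V x := by
        conv_rhs => rw [← fV]
        exact le_max_right _ _
      exact (min_le_iff.1 h2).resolve_left fun h => by linarith [D.g_of_notMem x ht]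
    have hn : x ∉ D.target ∪ D.avoid := fun h => h.elim ht ha
    have hR : -V x / D.M ≤ D.γ * ∫ a, ∫ x', -V x' / D.M ∂(D.P (x, a)) ∂(π x) := by
      simp only [integral_div, integral_neg]
      rw [← mul_div_assoc]
      gcongr
      linarith
    simp only [D.stateActionValue_of_notMem _ (show (x, _).1 ∉ _ from hn)]
    rw [lintegral_const_mul' _ _ ENNReal.ofReal_ne_top]
    refine (ENNReal.ofReal_le_ofReal hR).trans ?_
    rw [ENNReal.ofReal_mul D.γ_pos.le]
    gcongr
    -- Passing to the positive part inside both integrals only increases the mean.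
    refine (ofReal_integral_le_lintegral_ofReal _ _).trans (lintegral_mono fun a => ?_)
    exact ofReal_integral_le_lintegral_ofReal _ _

theorem neg_div_le_reachAvoidProb {V : S → ℝ} (hV : D.IsBellmanFixedPoint π V) (x : S) :
    -V x / D.M ≤ D.reachAvoidProb π x :=
  (ENNReal.ofReal_le_iff_le_toReal (measure_ne_top _ _)).1 (D.ofReal_neg_div_le_trajLaw π hV x)

end ReachAvoidMDP

theorem mainTheorem2 {S A : Type*} [MeasurableSpace S] [MeasurableSpace A]
    (D : ReachAvoidMDP S A) (π : Kernel S A) [IsMarkovKernel π] :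
    (∃! V : S → ℝ, D.IsBellmanFixedPoint π V) ∧
    ∀ V : S → ℝ, D.IsBellmanFixedPoint π V →
      (∀ x : S, V x < 0 → -V x / D.M ≤ D.reachAvoidProb π x) ∧
      (∀ p ∈ Set.Ioo (0 : ℝ) 1, {x : S | V x ≤ -(p * D.M)} ⊆ D.reachAvoidSet π p) := by
  refine ⟨D.existsUnique_isBellmanFixedPoint π, fun V hV =>
    ⟨fun x _ => D.neg_div_le_reachAvoidProb π hV x, fun p _ x hx => ?_⟩⟩
  refine le_trans ?_ (D.neg_div_le_reachAvoidProb π hV x)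
  rw [le_div_iff₀ D.M_pos]
  exact le_neg_of_le_neg hx
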